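/- Let $G=(V,E,\omega)$ be a finite weighted directed graph (loops allowed, at most one edge from a vertex to another, weights $\omega:E\to\mathbb{R}$). Its spectrum $\sigma(G)$ is the multiset of eigenvalues in $\mathbb{C}$, counted with algebraic multiplicity, of the weighted adjacency matrix whose entry $(i,j)$ is the weight of the edge from $v_j$ to $v_i$ if there is one, and $0$ otherwise. For $S\subseteq V$, $G|_S$ is the subgraph of $G$ induced on $S$. Let $B\subseteq V$, let $\bar B=V\setminus B$, and let $C_1,\dots,C_m$ be the strongly connected components of $G|_{\bar B}$ (a single vertex counts as strongly connected). A component branch of $G$ with respect to $B$ is an ordered sequence $\beta=\{v,e_0,D_1,e_1,D_2,\dots,D_r,e_r,w\}$ with $r\ge 0$, where $v,w\in B$ (possibly $v=w$), $D_1,\dots,D_r$ are distinct strongly connected components of $G|_{\bar B}$, and $e_0,\dots,e_r\in E$ are such that $e_0$ begins at $v$, $e_k$ begins at a vertex of $D_k$ for $1\le k\le r$, $e_k$ ends at a vertex of $D_{k+1}$ for $0\le k<r$, and $e_r$ ends at $w$. The specialization $\mathcal{S}_B(G)$ is the weighted directed graph obtained by taking all vertices of $B$ once, taking for every component branch $\beta$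 separate copies of the components $D_1,\dots,D_r$ on it (with all their internal edges), joined to one another and to $v,w\in B$ by copies of the edges $e_0,\dots,e_r$, and letting every edge inherit its weight from $G$. (A branch with $r=0$ contributes just its edge $e_0$ between vertices of $B$.) Let $n_i\ge 0$ be the number of copies of $C_i$ in $\mathcal{S}_B(G)$. Then $$\sigma\big(\mathcal{S}_B(G)\big)=\sigma(G)\cup\sigma(C_1)^{n_1-1}\cup\sigma(C_2)^{n_2-1}\cup\dots\cup\sigma(C_m)^{n_m-1}.$$ Here, for multisets, $\cup$ adds multiplicities, $A\cup S^{k}$ for $k\ge 0$ is the union of $A$ with $k$ copies of $S$, and $A\cup S^{-1}=A-S$ is the multiset difference (the multiplicity of $\alpha$ in $A-S$ is the larger of $0$ and its multiplicity in $A$ minus its multiplicity in $S$). The operations are carried out from left to right, and the identity holds for every numbering of the components. -/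

import Mathlib

/-- A weighted directed graph on the vertex set `V`: a digraph (loops allowed, at most one edge
from one vertex to another) together with a real weight for every edge. `G.Adj u v` says that
there is an edge which begins at `u` and ends at `v`. -/
structure WeightedDigraph (V : Type*) extends Digraph V where
  /-- The weight of an edge. -/
  weight : ∀ ⦃u v : V⦄, Adj u v → ℝ

namespace WeightedDigraph

variable {V : Type*}

open Classical in
/-- The weighted adjacency matrix: the entry `(i, j)` is the weight of the edge that begins at `j`
and ends at `i`, and `0` if there is no such edge. -/
noncomputable def adjMatrix (G : WeightedDigraph V) : Matrix V V ℝ :=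
  Matrix.of fun i j => if h : G.Adj j i then G.weight h else 0

/-- The spectrum of a finite weighted digraph: the multiset of the complex roots, with
multiplicity, of the characteristic polynomial of its weighted adjacency matrix. -/
noncomputable def spectrum [Finite V] (G : WeightedDigraph V) : Multiset ℂ :=
  letI := Fintype.ofFinite V
  letI := Classical.decEq V
  (G.adjMatrix.map (algebraMap ℝ ℂ)).charpoly.roots

/-- The restriction of `G` to the set `S` of vertices. -/
def restrict (G : WeightedDigraph V) (S : Set V) : WeightedDigraph S where
  Adj u v := G.Adj u v
  weight _ _ h := G.weight h

/-- A graph is strongly connected if it has a vertex and every vertex can be reached from every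
vertex along directed edges (each vertex is reached from itself by the trivial path). -/
def StronglyConnected (G : WeightedDigraph V) : Prop :=
  Nonempty V ∧ ∀ u v : V, Relation.ReflTransGen G.Adj u v

/-- `S` is the vertex set of a strongly connected component of `G`: it is maximal among the sets of
vertices on which `G` restricts to a strongly connected graph. The component itself is the graph
`G.restrict S`. -/
def IsSCC (G : WeightedDigraph V) (S : Set V) : Prop :=
  Maximal (fun T : Set V => (G.restrict T).StronglyConnected) S

/-- The strongly connected components (given by their vertex sets) of the restriction of `G` to the
complement of `B`. -/
abbrev Component (G : WeightedDigraph V) (B : Set V) : Type _ :=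
  {S : Set ↥Bᶜ // (G.restrict Bᶜ).IsSCC S}

/-- A component as a weighted digraph. -/
def Component.graph {G : WeightedDigraph V} {B : Set V} (C : G.Component B) :
    WeightedDigraph C.1 :=
  (G.restrict Bᶜ).restrict C.1

/-- A component branch `{v_i, e_0, C_1, e_1, C_2, …, C_m, e_m, v_j}` of `G` with respect to `B`,
where `m = length` may be zero. The component `C_{k+1}` is `comp k`; the edge `e_k` begins at
`src k` and ends at `tgt k`; the end points of the branch are `v_i = src 0` and
`v_j = tgt (Fin.last length)`. -/
structure ComponentBranch (G : WeightedDigraph V) (B : Set V) where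
  /-- The number of components on the branch. -/
  length : ℕ
  /-- The components on the branch, in order. -/
  comp : Fin length → G.Component B
  /-- The vertices at which the edges `e_0, …, e_m` begin. -/
  src : Fin (length + 1) → V
  /-- The vertices at which the edges `e_0, …, e_m` end. -/
  tgt : Fin (length + 1) → V
  /-- The components on the branch are distinct. -/
  comp_injective : Function.Injective comp
  adj : ∀ k, G.Adj (src k) (tgt k)
  src_zero_mem : src 0 ∈ B
  src_succ_mem : ∀ k : Fin length, ∃ x ∈ (comp k).1, (x : V) = src k.succ
  tgt_castSucc_mem : ∀ k : Fin length, ∃ x ∈ (comp k).1, (x : V) = tgt k.castSucc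
  tgt_last_mem : tgt (Fin.last length) ∈ B

/-- A finite graph has finitely many component branches. -/
instance [Finite V] (G : WeightedDigraph V) (B : Set V) : Finite (G.ComponentBranch B) := by
  have hle : ∀ β : G.ComponentBranch B, β.length < Nat.card (G.Component B) + 1 := fun β => by
    have h := Nat.card_le_card_of_injective _ β.comp_injective
    rw [Nat.card_fin] at h
    omega
  let f : G.ComponentBranch B → Σ m : Fin (Nat.card (G.Component B) + 1),
      (Fin m → G.Component B) × (Fin (m + 1) → V) × (Fin (m + 1) → V) :=
    fun β => ⟨⟨β.length, hle β⟩, β.comp, β.src, β.tgt⟩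
  refine Finite.of_injective f ?_
  rintro ⟨m, c, s, t, _, _, _, _, _, _⟩ ⟨m', c', s', t', _, _, _, _, _, _⟩ h
  simp only [f, Sigma.mk.injEq, Fin.mk.injEq] at h
  obtain ⟨rfl, h⟩ := h
  simp only [heq_eq_eq, Prod.mk.injEq] at h
  obtain ⟨rfl, rfl, rfl⟩ := h
  rfl

/-- The vertices of the specialization of `G` over `B`: the vertices in `B` (each of them once), and
for every component branch `β` and every position `k` on it, a separate copy of the vertices of the
component at that position. -/
abbrev SpecVertex (G : WeightedDigraph V) (B : Set V) : Type _ :=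
  ↥B ⊕ (Σ β : G.ComponentBranch B, Σ k : Fin β.length, ↥(β.comp k).1)

/-- The vertex of `G` of which a vertex of the specialization is a copy. -/
def SpecVertex.orig {G : WeightedDigraph V} {B : Set V} : G.SpecVertex B → V
  | .inl b => b
  | .inr ⟨_, _, x⟩ => (x : ↥Bᶜ)

namespace ComponentBranch

variable {G : WeightedDigraph V} {B : Set V}

/-- The edge from `x` to `y` lies inside the copy of some component on the branch `β`. -/
def InnerAdj (β : G.ComponentBranch B) (x y : G.SpecVertex B) : Prop :=
  ∃ (k : Fin β.length) (u v : ↥(β.comp k).1),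
    x = .inr ⟨β, k, u⟩ ∧ y = .inr ⟨β, k, v⟩ ∧ (β.comp k).graph.Adj u v

/-- The vertex `x` of the specialization is the one at which the edge `e_k` of the branch `β`
begins: it is the copy of `src k` in `B` if `k = 0`, and in the `k`-th component of `β` otherwise. -/
def IsSrc (β : G.ComponentBranch B) (k : Fin (β.length + 1)) (x : G.SpecVertex B) : Prop :=
  x.orig = β.src k ∧
    ((k = 0 ∧ ∃ b, x = .inl b) ∨ ∃ (l : Fin β.length) (u : _), k = l.succ ∧ x = .inr ⟨β, l, u⟩)

/-- The vertex `y` of the specialization is the one at which the edge `e_k` of the branch `β`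
ends: it is the copy of `tgt k` in `B` if `k = m`, and in the `(k+1)`-st component of `β`
otherwise. -/
def IsTgt (β : G.ComponentBranch B) (k : Fin (β.length + 1)) (y : G.SpecVertex B) : Prop :=
  y.orig = β.tgt k ∧
    ((k = Fin.last β.length ∧ ∃ b, y = .inl b) ∨
      ∃ (l : Fin β.length) (u : _), k = l.castSucc ∧ y = .inr ⟨β, l, u⟩)

/-- There is an edge of the branch `β` from `x` to `y`: an edge inside a component, or one of the
edges `e_0, …, e_m`. -/
def BranchAdj (β : G.ComponentBranch B) (x y : G.SpecVertex B) : Prop :=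
  β.InnerAdj x y ∨ ∃ k, β.IsSrc k x ∧ β.IsTgt k y

theorem BranchAdj.orig_adj {β : G.ComponentBranch B} {x y : G.SpecVertex B}
    (h : β.BranchAdj x y) : G.Adj x.orig y.orig := by
  rcases h with ⟨k, u, v, rfl, rfl, h⟩ | ⟨k, hx, hy⟩
  · exact h
  · rw [hx.1, hy.1]
    exact β.adj k

end ComponentBranch

/-- The specialization of `G` over the base `B`: the union of all component branches, in which the
vertices of `B` are identified and everything else is kept separate. Edges inherit their
weights from `G`. -/
def specialization (G : WeightedDigraph V) (B : Set V) : WeightedDigraph (G.SpecVertex B) where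
  Adj x y := ∃ β : G.ComponentBranch B, β.BranchAdj x y
  weight x y h := G.weight (u := x.orig) (v := y.orig) (h.elim fun _ hβ => hβ.orig_adj)

/-- The number of copies of the component `C` in the specialization of `G` over `B`. -/
noncomputable def numCopies (G : WeightedDigraph V) (B : Set V) (C : G.Component B) : ℕ :=
  Nat.card {p : Σ β : G.ComponentBranch B, Fin β.length // p.1.comp p.2 = C}

end WeightedDigraph

/-- `A ∪ S ^ k` for multisets `A`, `S` and an integer `k`: the union, with multiplicities added, of
`A` and `k` copies of `S` if `0 ≤ k`, and the multiset difference of `A` and `-k` copies of `S`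
if `k < 0`. -/
noncomputable def adjoinCopies (A S : Multiset ℂ) (k : ℤ) : Multiset ℂ :=
  if 0 ≤ k then A + k.toNat • S else A - (-k).toNat • S

/-! Fix `lam` outside the spectra of all components of the complement of `B`, and let `K` be the
block diagonal matrix of the resolvents of these components. Write the adjacency matrix as inner
part (edges inside a component) plus outer part `a`. Off `B` the outer edges never return to a
component they have left, so the series of the `(a * K) ^ r * a` is finite; its sum is `walkMatrix`.
Eliminating the vertices outside `B` gives `χ_G(lam) = det (lam - walkMatrix)_B * ∏ χ_C(lam)`
(`IsBlockResolvent.eval_charpoly`).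

An entry of `walkMatrix` between vertices of `B` is the sum over component branches of their path
weights (`IsBlockResolvent.walkMatrix_apply`). The specialization keeps exactly these branches, made
disjoint off `B`, so eliminating the copies leaves the same determinant on `B`, while the eliminated
block contributes `∏ χ_C(lam) ^ n_C` (`IsBlockResolvent.eval_charpoly_specialization`). Only
finitely many `lam` are excluded, hence `χ_S * ∏ χ_C = χ_G * ∏ χ_C ^ n_C` as polynomials
(`charpoly_specialization_mul`), and taking roots gives an additive identity of multisets.

To solve it for the spectrum of the specialization, the truncated differences must lose nothing.
Subtraction occurs only when `n_C = 0`; such a `C` is a strongly connected component of `G` itself,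
so all the subtracted spectra together are contained in that of `G` (`sum_spectrum_le`). Then
`foldl_adjoinCopies_eq` applies in any order. -/

/-! ### Block triangular matrices and elimination -/

/-- The characteristic polynomial of a matrix which is block triangular with respect to a
height function on the blocks. -/
theorem Matrix.charpoly_eq_prod_of_height {J R : Type*} {X : J → Type*} [CommRing R] [Fintype J]
    [∀ j, Fintype (X j)] [DecidableEq (Σ j, X j)] [∀ j, DecidableEq (X j)]
    (M : Matrix (Σ j, X j) (Σ j, X j) R) (h : J → ℕ)
    (hM : ∀ x y, M x y ≠ 0 → x.1 = y.1 ∨ h y.1 < h x.1) :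
    M.charpoly = ∏ j, (M.submatrix (Sigma.mk j) (Sigma.mk j)).charpoly := by
  -- Block triangularity needs a linear order: larger heights come first, and an arbitrary numbering
  -- breaks ties.
  let g : J → ℕᵒᵈ ×ₗ Fin (Fintype.card J) := fun j =>
    toLex (OrderDual.toDual (h j), Fintype.equivFin J j)
  have hg : Function.Injective g := fun i j hij => by
    have := congrArg (fun p => (ofLex p).2) hij
    exact (Fintype.equivFin J).injective this
  let _ : LinearOrder J := LinearOrder.lift' g hg
  have hb : M.BlockTriangular (Sigma.fst : (Σ j, X j) → J) := by
    intro x y hxy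
    by_contra hne
    have hxy' : g y.1 < g x.1 := hxy
    rcases hM x y hne with h1 | h1
    · rw [h1] at hxy'
      exact lt_irrefl _ hxy'
    · refine lt_asymm hxy' ?_
      exact Prod.Lex.toLex_lt_toLex.2 (Or.inl h1)
  rw [Matrix.charpoly, hb.charmatrix.det_fintype]
  refine Finset.prod_congr rfl fun j _ => ?_
  rw [← Matrix.charmatrix_toSquareBlock, ← Matrix.charpoly,
    ← Matrix.charpoly_reindex (Equiv.sigmaSubtype j)]
  rfl

/-- Determinant of a matrix on `B ⊕ T`, given a solution `Z` of the equations in the rows `T`. -/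
theorem Matrix.det_eq_det_mul_det_of_solution {B T R : Type*} [CommRing R] [Fintype B] [Fintype T]
    [DecidableEq B] [DecidableEq T] (M : Matrix (B ⊕ T) (B ⊕ T) R) (Z : Matrix (B ⊕ T) B R)
    (hB : ∀ b b', Z (.inl b) b' = (1 : Matrix B B R) b b')
    (hT : ∀ t b, (M * Z) (.inr t) b = 0) :
    M.det = (Matrix.of fun b b' => (M * Z) (.inl b) b').det * (M.toBlocks₂₂).det := by
  -- A column operation of determinant one clears the lower left block, so the block on `T` need not
  -- be invertible.
  let N : Matrix (B ⊕ T) (B ⊕ T) R :=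
    Matrix.fromBlocks 1 0 (Matrix.of fun t b => Z (.inr t) b) 1
  have hZ : M * N =
      Matrix.fromBlocks (Matrix.of fun b b' => (M * Z) (.inl b) b') M.toBlocks₁₂ 0
        M.toBlocks₂₂ := by
    ext i j
    rcases j with j | j
    · have : (M * N) i (.inl j) =
          (M * Z) i j := by
        simp only [N, Matrix.mul_apply, Fintype.sum_sum_type, hB, Matrix.fromBlocks_apply₁₁,
          Matrix.fromBlocks_apply₂₁, Matrix.of_apply]
      rw [this]
      rcases i with i | i
      · simp
      · simp [hT]
    · rcases i with i | i <;>
        simp [N, Matrix.mul_apply, Fintype.sum_sum_type, Matrix.one_apply, Matrix.toBlocks₁₂,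
          Matrix.toBlocks₂₂]
  have := congrArg Matrix.det hZ
  rwa [Matrix.det_mul, Matrix.det_fromBlocks_zero₁₂, Matrix.det_fromBlocks_zero₂₁, Matrix.det_one,
    Matrix.det_one, mul_one, mul_one] at this

/-! ### Strongly connected components and the characteristic polynomial -/

namespace WeightedDigraph

/-- The complexified weighted adjacency matrix. -/
noncomputable def cMatrix {V : Type*} (G : WeightedDigraph V) : Matrix V V ℂ :=
  G.adjMatrix.map (algebraMap ℝ ℂ)

theorem adj_of_cMatrix_ne_zero {V : Type*} {G : WeightedDigraph V} {x y : V}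
    (h : G.cMatrix x y ≠ 0) : G.Adj y x := by
  by_contra hn
  exact h (by simp [cMatrix, adjMatrix, hn])

theorem spectrum_eq_roots {V : Type*} [Finite V] [Fintype V] [DecidableEq V]
    (G : WeightedDigraph V) : G.spectrum = G.cMatrix.charpoly.roots := by
  unfold spectrum cMatrix
  convert rfl

theorem cMatrix_restrict {V : Type*} (G : WeightedDigraph V) (S : Set V) :
    (G.restrict S).cMatrix = G.cMatrix.submatrix Subtype.val Subtype.val := by
  ext i j
  simp only [cMatrix, adjMatrix, Matrix.map_apply, Matrix.of_apply, Matrix.submatrix_apply]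
  rfl

variable {W : Type*} {H : WeightedDigraph W}

/-- The vertices that are mutually reachable with `x`. -/
def sccOf (H : WeightedDigraph W) (x : W) : Set W :=
  {y | Relation.ReflTransGen H.Adj x y ∧ Relation.ReflTransGen H.Adj y x}

theorem mem_sccOf_self (x : W) : x ∈ H.sccOf x :=
  ⟨Relation.ReflTransGen.refl, Relation.ReflTransGen.refl⟩

theorem reflTransGen_of_restrict {S : Set W} {u v : S}
    (h : Relation.ReflTransGen (H.restrict S).Adj u v) :
    Relation.ReflTransGen H.Adj (u : W) v :=
  h.lift Subtype.val fun _ _ h => h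

theorem subset_sccOf {S : Set W} (hS : (H.restrict S).StronglyConnected) {x : W} (hx : x ∈ S) :
    S ⊆ H.sccOf x := fun y hy =>
  ⟨reflTransGen_of_restrict (hS.2 ⟨x, hx⟩ ⟨y, hy⟩),
    reflTransGen_of_restrict (hS.2 ⟨y, hy⟩ ⟨x, hx⟩)⟩

/-- A path that starts and ends in the class of `x` cannot leave it: every vertex on the way is
reachable from `x` and reaches `x`. -/
theorem reflTransGen_restrict_sccOf {x u v : W} (hxu : Relation.ReflTransGen H.Adj x u)
    (huv : Relation.ReflTransGen H.Adj u v) (hvx : Relation.ReflTransGen H.Adj v x)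
    (hu : u ∈ H.sccOf x) (hv : v ∈ H.sccOf x) :
    Relation.ReflTransGen (H.restrict (H.sccOf x)).Adj ⟨u, hu⟩ ⟨v, hv⟩ := by
  induction huv with
  | refl => exact Relation.ReflTransGen.refl
  | @tail y z h1 h2 ih =>
    have hy : y ∈ H.sccOf x := ⟨hxu.trans h1, Relation.ReflTransGen.head h2 hvx⟩
    refine Relation.ReflTransGen.tail (ih hy.2 hy) ?_
    exact h2

theorem isSCC_sccOf (x : W) : H.IsSCC (H.sccOf x) := by
  refine ⟨⟨⟨⟨x, mem_sccOf_self x⟩⟩, fun u v => ?_⟩, fun T hT hle => ?_⟩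
  · exact reflTransGen_restrict_sccOf u.2.1 (u.2.2.trans v.2.1) v.2.2 u.2 v.2
  · exact subset_sccOf hT (hle (mem_sccOf_self x))

theorem IsSCC.eq_sccOf {S : Set W} (hS : H.IsSCC S) {x : W} (hx : x ∈ S) : S = H.sccOf x :=
  Maximal.eq_of_subset hS (isSCC_sccOf x).prop (subset_sccOf hS.prop hx)

theorem IsSCC.nonempty {S : Set W} (hS : H.IsSCC S) : S.Nonempty := by
  obtain ⟨⟨x⟩, _⟩ := hS.prop
  exact ⟨x, x.2⟩

theorem IsSCC.eq_of_mem {S T : Set W} (hS : H.IsSCC S) (hT : H.IsSCC T) {x : W} (hx : x ∈ S)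
    (hx' : x ∈ T) : S = T :=
  (hS.eq_sccOf hx).trans (hT.eq_sccOf hx').symm

/-- The number of vertices from which `x` can be reached. -/
noncomputable def height (H : WeightedDigraph W) (x : W) : ℕ :=
  {y | Relation.ReflTransGen H.Adj y x}.ncard

theorem height_le [Finite W] (x : W) : H.height x ≤ Nat.card W := by
  rw [← Set.ncard_univ]
  exact Set.ncard_le_ncard (Set.subset_univ _)

theorem height_eq_of_mem {x y : W} (h : y ∈ H.sccOf x) : H.height y = H.height x := by
  unfold height
  congr 1
  ext z
  exact ⟨fun hz => hz.trans h.2, fun hz => hz.trans h.1⟩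

/-- Whatever reaches `x` reaches `y`, and `y` reaches itself but not `x`. -/
theorem height_lt [Finite W] {x y : W} (h : H.Adj x y) (hn : y ∉ H.sccOf x) :
    H.height x < H.height y := by
  refine Set.ncard_lt_ncard ⟨fun z hz => Relation.ReflTransGen.tail hz h, fun hle => hn ?_⟩
  exact ⟨.single h, hle Relation.ReflTransGen.refl⟩

/-- Every vertex lies in exactly one strongly connected component. -/
noncomputable def sigmaSCCEquiv (H : WeightedDigraph W) :
    (Σ S : {S : Set W // H.IsSCC S}, ↥S.1) ≃ W :=
  Equiv.ofBijective (fun p => p.2) <| by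
    refine ⟨?_, fun x => ⟨⟨⟨_, isSCC_sccOf x⟩, ⟨x, mem_sccOf_self x⟩⟩, rfl⟩⟩
    rintro ⟨⟨S, hS⟩, ⟨x, hx⟩⟩ ⟨⟨T, hT⟩, ⟨y, hy⟩⟩ h
    obtain rfl : x = y := h
    obtain rfl : S = T := hS.eq_of_mem hT hx hy
    rfl

open scoped Classical in
/-- The characteristic polynomial is the product over the strongly connected components. -/
theorem charpoly_eq_prod_scc [Fintype W] [DecidableEq W] (H : WeightedDigraph W) :
    H.cMatrix.charpoly =
      ∏ S : {S : Set W // H.IsSCC S}, (H.restrict S.1).cMatrix.charpoly := by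
  rw [← Matrix.charpoly_reindex H.sigmaSCCEquiv.symm,
    Matrix.charpoly_eq_prod_of_height _ (fun S => H.height S.2.nonempty.some)]
  · refine Finset.prod_congr rfl fun S _ => ?_
    rw [cMatrix_restrict]
    rfl
  · rintro ⟨S, x⟩ ⟨T, y⟩ hne
    have hadj : H.Adj y.1 x.1 := adj_of_cMatrix_ne_zero hne
    by_cases hx : x.1 ∈ H.sccOf y.1
    · left
      exact Subtype.ext (S.2.eq_of_mem T.2 x.2 ((T.2.eq_sccOf y.2) ▸ hx))
    · right
      have := height_lt hadj hx
      rwa [height_eq_of_mem (x := y.1) (y := T.2.nonempty.some)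
          (by rw [← T.2.eq_sccOf y.2]; exact T.2.nonempty.some_mem),
        height_eq_of_mem (x := x.1) (y := S.2.nonempty.some)
          (by rw [← S.2.eq_sccOf x.2]; exact S.2.nonempty.some_mem)]

end WeightedDigraph

/-! ### Exactness of the truncated differences -/

/-- Multiset arithmetic for iterated `adjoinCopies`. -/
theorem foldl_adjoinCopies_eq {ι : Type*} (σ : ι → Multiset ℂ) (n : ι → ℕ) (l : List ι)
    (T A : Multiset ℂ) (h : T + (l.map σ).sum = A + (l.map fun i => n i • σ i).sum)
    (hA : (l.map fun i => if n i = 0 then σ i else 0).sum ≤ A) :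
    l.foldl (fun A i => adjoinCopies A (σ i) ((n i : ℤ) - 1)) A = T := by
  induction l generalizing A with
  | nil => simpa using h.symm
  | cons i l ih =>
    simp only [List.map_cons, List.sum_cons, List.foldl_cons] at h hA ⊢
    apply ih
    -- Only `n i = 0` gives a genuine subtraction, and there `hA` makes it exact.
    · rcases Nat.eq_zero_or_pos (n i) with hi | hi
      · have hle : σ i ≤ A := le_trans (by simp [hi]) hA
        have : adjoinCopies A (σ i) ((n i : ℤ) - 1) = A - σ i := by
          simp [adjoinCopies, hi]
        rw [this]
        rw [hi, zero_nsmul, zero_add] at h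
        apply add_right_cancel (b := σ i)
        calc _ = T + (σ i + (l.map σ).sum) := by abel
          _ = _ := h
          _ = A - σ i + σ i + (l.map fun i => n i • σ i).sum := by
            rw [tsub_add_cancel_of_le hle]
          _ = _ := add_right_comm _ _ _
      · obtain ⟨k, hk⟩ : ∃ k, n i = k + 1 := ⟨n i - 1, by omega⟩
        have : adjoinCopies A (σ i) ((n i : ℤ) - 1) = A + k • σ i := by
          simp [adjoinCopies, hk]
        rw [this]
        apply add_right_cancel (b := σ i)
        rw [hk, succ_nsmul] at h
        calc _ = T + (σ i + (l.map σ).sum) := by abel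
          _ = _ := h
          _ = _ := by abel
    · rcases Nat.eq_zero_or_pos (n i) with hi | hi
      · have : adjoinCopies A (σ i) ((n i : ℤ) - 1) = A - σ i := by
          simp [adjoinCopies, hi]
        rw [this]
        rw [if_pos hi] at hA
        exact le_tsub_of_add_le_left hA
      · obtain ⟨k, hk⟩ : ∃ k, n i = k + 1 := ⟨n i - 1, by omega⟩
        have : adjoinCopies A (σ i) ((n i : ℤ) - 1) = A + k • σ i := by
          simp [adjoinCopies, hk]
        rw [this]
        rw [if_neg (by omega), zero_add] at hA
        exact hA.trans (Multiset.le_add_right _ _)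

/-! ### Components off `B` and their resolvents -/

namespace WeightedDigraph

variable {V : Type*} {G : WeightedDigraph V} {B : Set V}

/-- The vertices of a component, as a set of vertices of the whole graph. -/
def Component.support (C : G.Component B) : Set V := {x | ∃ u ∈ C.1, (u : V) = x}

theorem Component.mem_support (C : G.Component B) (u : C.1) : (u : V) ∈ C.support :=
  ⟨u.1, u.2, rfl⟩

theorem Component.exists_eq_of_mem_support {C : G.Component B} {x : V} (hx : x ∈ C.support) :
    ∃ u : C.1, (u : V) = x := by
  obtain ⟨u, hu, rfl⟩ := hx
  exact ⟨⟨u, hu⟩, rfl⟩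

theorem Component.not_mem_of_mem_support {C : G.Component B} {x : V} (hx : x ∈ C.support) :
    x ∉ B := by
  obtain ⟨u, _, rfl⟩ := hx
  exact u.2

theorem Component.eq_of_mem_support {C C' : G.Component B} {x : V} (hx : x ∈ C.support)
    (hx' : x ∈ C'.support) : C = C' := by
  obtain ⟨u, hu, rfl⟩ := hx
  obtain ⟨u', hu', h⟩ := hx'
  obtain rfl : u' = u := Subtype.ext h
  exact Subtype.ext (C.2.eq_of_mem C'.2 hu hu')

theorem exists_mem_support {x : V} (hx : x ∉ B) : ∃ C : G.Component B, x ∈ C.support :=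
  ⟨⟨_, isSCC_sccOf ⟨x, hx⟩⟩, ⟨x, hx⟩, mem_sccOf_self _, rfl⟩

theorem Component.coe_injective (C : G.Component B) :
    Function.Injective (fun u : C.1 => (u : V)) :=
  Subtype.val_injective.comp Subtype.val_injective

variable (G B) in
/-- Two vertices lie in the same component of the complement of `B`. -/
def SameComp (x y : V) : Prop := ∃ C : G.Component B, x ∈ C.support ∧ y ∈ C.support

theorem SameComp.symm {x y : V} (h : G.SameComp B x y) : G.SameComp B y x :=
  h.imp fun _ h => h.symm

theorem SameComp.trans {x y z : V} (h : G.SameComp B x y) (h' : G.SameComp B y z) :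
    G.SameComp B x z := by
  obtain ⟨C, hx, hy⟩ := h
  obtain ⟨C', hy', hz⟩ := h'
  obtain rfl := Component.eq_of_mem_support hy hy'
  exact ⟨C, hx, hz⟩

theorem sameComp_self {x : V} (hx : x ∉ B) : G.SameComp B x x :=
  (exists_mem_support hx).imp fun _ h => ⟨h, h⟩

theorem SameComp.left_not_mem {x y : V} (h : G.SameComp B x y) : x ∉ B :=
  Component.not_mem_of_mem_support h.choose_spec.1

theorem SameComp.right_not_mem {x y : V} (h : G.SameComp B x y) : y ∉ B :=
  h.symm.left_not_mem

theorem SameComp.mem_support {x y : V} (h : G.SameComp B x y) {C : G.Component B}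
    (hx : x ∈ C.support) : y ∈ C.support := by
  obtain ⟨C', hx', hy⟩ := h
  rwa [Component.eq_of_mem_support hx hx']

theorem sameComp_iff_mem_sccOf {x y : V} (hx : x ∉ B) (hy : y ∉ B) :
    G.SameComp B x y ↔ (⟨y, hy⟩ : ↥Bᶜ) ∈ (G.restrict Bᶜ).sccOf ⟨x, hx⟩ := by
  constructor
  · rintro ⟨C, ⟨u, hu, rfl⟩, ⟨v, hv, rfl⟩⟩
    exact C.2.eq_sccOf hu ▸ hv
  · intro h
    exact ⟨⟨_, isSCC_sccOf ⟨x, hx⟩⟩, ⟨⟨x, hx⟩, mem_sccOf_self _, rfl⟩, ⟨⟨y, hy⟩, h, rfl⟩⟩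

variable (G B) in
open scoped Classical in
/-- The number of vertices outside `B` from which `x` can be reached outside `B`. -/
noncomputable def outerHeight (x : V) : ℕ :=
  if hx : x ∉ B then (G.restrict Bᶜ).height ⟨x, hx⟩ else 0

theorem outerHeight_le [Finite V] (x : V) : G.outerHeight B x ≤ Nat.card V := by
  by_cases hx : x ∉ B
  · rw [outerHeight, dif_pos hx]
    exact (height_le _).trans (Nat.card_le_card_of_injective _ Subtype.val_injective)
  · rw [outerHeight, dif_neg hx]
    exact Nat.zero_le _

theorem SameComp.outerHeight_eq {x y : V} (h : G.SameComp B x y) :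
    G.outerHeight B x = G.outerHeight B y := by
  have hx := h.left_not_mem
  have hy := h.right_not_mem
  rw [outerHeight, dif_pos hx, outerHeight, dif_pos hy]
  exact (height_eq_of_mem ((sameComp_iff_mem_sccOf hx hy).1 h)).symm

theorem outerHeight_lt [Finite V] {x y : V} (h : G.Adj x y) (hx : x ∉ B) (hy : y ∉ B)
    (hn : ¬ G.SameComp B x y) : G.outerHeight B x < G.outerHeight B y := by
  rw [outerHeight, dif_pos hx, outerHeight, dif_pos hy]
  refine height_lt ?_ fun h' => hn ((sameComp_iff_mem_sccOf hx hy).2 h')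
  exact h

theorem cMatrix_component (C : G.Component B) :
    C.graph.cMatrix = G.cMatrix.submatrix (fun u : C.1 => (u : V)) (fun u : C.1 => (u : V)) := by
  rw [Component.graph, cMatrix_restrict, cMatrix_restrict]
  rfl

variable (G B) in
open scoped Classical in
/-- The part of the adjacency matrix that comes from the edges inside the components. -/
noncomputable def innerMatrix : Matrix V V ℂ :=
  Matrix.of fun x y => if G.SameComp B x y then G.cMatrix x y else 0

variable (G B) in
open scoped Classical in
/-- The part of the adjacency matrix that comes from the edges which are not inside a
component. -/
noncomputable def outerMatrix : Matrix V V ℂ :=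
  Matrix.of fun x y => if G.SameComp B x y then 0 else G.cMatrix x y

variable (G B) in
/-- `K` is the block diagonal matrix formed by the resolvents at `lam` of the components. -/
structure IsBlockResolvent [Fintype V] (lam : ℂ) (K : Matrix V V ℂ) : Prop where
  sameComp : ∀ {x y}, K x y ≠ 0 → G.SameComp B x y
  equation : ∀ (C : G.Component B) [Fintype C.1] [DecidableEq V] (u : C.1) (y : V),
    lam * K u y - ∑ u' : C.1, G.cMatrix u u' * K u' y = if (u : V) = y then 1 else 0

open scoped Classical in
theorem exists_isBlockResolvent [Fintype V] (lam : ℂ)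
    (h : ∀ C : G.Component B, C.graph.cMatrix.charpoly.eval lam ≠ 0) :
    ∃ K, G.IsBlockResolvent B lam K := by
  let R : ∀ C : G.Component B, Matrix C.1 C.1 ℂ := fun C =>
    (Matrix.scalar C.1 lam - C.graph.cMatrix)⁻¹
  have hR : ∀ C, (Matrix.scalar C.1 lam - C.graph.cMatrix) * R C = 1 := fun C =>
    Matrix.mul_nonsing_inv _ (isUnit_iff_ne_zero.2 (by rw [← Matrix.eval_charpoly]; exact h C))
  -- Components are disjoint, so at most one term of this sum is nonzero.
  let K : Matrix V V ℂ := Matrix.of fun x y =>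
    ∑ C : G.Component B, ∑ u : C.1, ∑ v : C.1, if (u : V) = x ∧ (v : V) = y then R C u v else 0
  have hK : ∀ (C : G.Component B) (u v : C.1), K u v = R C u v := by
    intro C u v
    simp only [K, Matrix.of_apply]
    rw [Finset.sum_eq_single C, Finset.sum_eq_single u, Finset.sum_eq_single v]
    · simp
    · intro w _ hw
      exact if_neg fun h => hw (C.coe_injective h.2)
    · simp
    · intro w _ hw
      exact Finset.sum_eq_zero fun _ _ => if_neg fun h => hw (C.coe_injective h.1)
    · simp
    · intro C' _ hC'
      refine Finset.sum_eq_zero fun u' _ => Finset.sum_eq_zero fun _ _ => if_neg fun h => hC' ?_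
      exact Component.eq_of_mem_support (h.1 ▸ C'.mem_support u') (C.mem_support u)
    · simp
  have hsupp : ∀ {x y}, K x y ≠ 0 → G.SameComp B x y := by
    intro x y hxy
    obtain ⟨C, _, hC⟩ := Finset.exists_ne_zero_of_sum_ne_zero hxy
    obtain ⟨u, _, hu⟩ := Finset.exists_ne_zero_of_sum_ne_zero hC
    obtain ⟨v, _, hv⟩ := Finset.exists_ne_zero_of_sum_ne_zero hu
    have := (ite_ne_right_iff.1 hv).1
    exact ⟨C, this.1 ▸ C.mem_support u, this.2 ▸ C.mem_support v⟩
  refine ⟨K, hsupp, ?_⟩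
  intro C iF iD u y
  obtain rfl : iF = Subtype.fintype _ := Subsingleton.elim _ _
  obtain rfl : iD = fun a b => Classical.propDecidable (a = b) := Subsingleton.elim _ _
  by_cases hy : y ∈ C.support
  · obtain ⟨v, rfl⟩ := Component.exists_eq_of_mem_support hy
    have := congrFun (congrFun (hR C) u) v
    rw [sub_mul, Matrix.sub_apply, Matrix.scalar_apply, Matrix.diagonal_mul, Matrix.mul_apply,
      Matrix.one_apply, cMatrix_component] at this
    simp only [hK, C.coe_injective.eq_iff]
    exact this
  · have h0 : ∀ u' : C.1, K u' y = 0 := fun u' => by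
      by_contra hne
      exact hy ((hsupp hne).mem_support (C.mem_support u'))
    have huy : (u : V) ≠ y := fun h => hy (h ▸ C.mem_support u)
    simp [h0, huy]

theorem sum_innerMatrix_mul [Fintype V] (C : G.Component B) [Fintype C.1] (u : C.1)
    (f : V → ℂ) : ∑ w, G.innerMatrix B u w * f w = ∑ u' : C.1, G.cMatrix u u' * f u' := by
  symm
  refine Fintype.sum_of_injective _ C.coe_injective _ _ (fun w hw => ?_) fun u' => ?_
  · rw [innerMatrix, Matrix.of_apply, if_neg, zero_mul]
    intro h
    obtain ⟨u', hu'⟩ := Component.exists_eq_of_mem_support (h.mem_support (C.mem_support u))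
    exact hw ⟨u', hu'⟩
  · rw [innerMatrix, Matrix.of_apply, if_pos ⟨C, C.mem_support u, C.mem_support u'⟩]

/-! ### Schur complement of the graph -/

section Schur

variable {lam : ℂ} {K : Matrix V V ℂ}

theorem innerMatrix_add_outerMatrix : G.innerMatrix B + G.outerMatrix B = G.cMatrix := by
  ext x y
  simp only [innerMatrix, outerMatrix, Matrix.add_apply, Matrix.of_apply]
  split_ifs <;> simp

theorem IsBlockResolvent.apply_eq_zero [Fintype V] (hK : G.IsBlockResolvent B lam K) {x : V}
    (hx : x ∈ B) (y : V) : K x y = 0 := by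
  by_contra h
  exact (hK.sameComp h).left_not_mem hx

variable [Fintype V] [DecidableEq V]

open scoped Classical in
theorem IsBlockResolvent.scalar_sub_mul (hK : G.IsBlockResolvent B lam K) :
    (Matrix.scalar V lam - G.innerMatrix B) * K =
      Matrix.diagonal fun x => if x ∈ B then 0 else 1 := by
  ext x y
  rw [sub_mul, Matrix.sub_apply, Matrix.scalar_apply, Matrix.diagonal_mul, Matrix.mul_apply,
    Matrix.diagonal_apply]
  by_cases hx : x ∈ B
  · have h0 : ∀ w, G.innerMatrix B x w = 0 := fun w => by
      rw [innerMatrix, Matrix.of_apply, if_neg fun h => h.left_not_mem hx]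
    simp [h0, hK.apply_eq_zero hx, hx]
  · obtain ⟨C, hC⟩ := exists_mem_support (G := G) hx
    obtain ⟨u, rfl⟩ := Component.exists_eq_of_mem_support hC
    rw [sum_innerMatrix_mul C u, hK.equation, if_neg hx]

-- This is the nilpotency off `B`. Rows are targets and columns sources, so a factor is read
-- backwards along edges: `K` stays in a component and the outer edge strictly lowers the height.
open scoped Classical in
theorem IsBlockResolvent.outerMatrix_mul_pow_apply (hK : G.IsBlockResolvent B lam K) (n : ℕ)
    {x y : V} (hx : x ∉ B) (h : ((G.outerMatrix B * K) ^ n) x y ≠ 0) :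
    y ∉ B ∧ G.outerHeight B y + n ≤ G.outerHeight B x := by
  induction n generalizing y with
  | zero =>
    rw [pow_zero, Matrix.one_apply] at h
    obtain rfl := (ite_ne_right_iff.1 h).1
    exact ⟨hx, le_rfl⟩
  | succ n ih =>
    rw [pow_succ, Matrix.mul_apply] at h
    obtain ⟨z, _, hz⟩ := Finset.exists_ne_zero_of_sum_ne_zero h
    obtain ⟨hzB, hzx⟩ := ih (left_ne_zero_of_mul hz)
    have h2 := right_ne_zero_of_mul hz
    rw [Matrix.mul_apply] at h2
    obtain ⟨w, _, hw⟩ := Finset.exists_ne_zero_of_sum_ne_zero h2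
    have hwy := hK.sameComp (right_ne_zero_of_mul hw)
    have hzw := left_ne_zero_of_mul hw
    rw [outerMatrix, Matrix.of_apply] at hzw
    obtain ⟨hn, hzw⟩ := ite_ne_left_iff.1 hzw
    have := outerHeight_lt (adj_of_cMatrix_ne_zero hzw.symm) hwy.left_not_mem hzB
      fun h => hn h.symm
    rw [hwy.outerHeight_eq] at this
    exact ⟨hwy.right_not_mem, by omega⟩

variable (G B) in
/-- The generating function of the walks that avoid `B`, except at their end points. -/
noncomputable def walkMatrix (K : Matrix V V ℂ) : Matrix V V ℂ :=
  -- Heights are at most `Nat.card V`, so the power `Nat.card V + 1` vanishes on rows outside `B`; a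
  -- row in `B` spends one further factor to leave `B`.
  ∑ r ∈ Finset.range (Nat.card V + 2), (G.outerMatrix B * K) ^ r * G.outerMatrix B

open scoped Classical in
/-- The Schur complement formula for the characteristic polynomial of a graph. -/
theorem IsBlockResolvent.eval_charpoly (hK : G.IsBlockResolvent B lam K) :
    G.cMatrix.charpoly.eval lam =
      (Matrix.of fun b b' : B => (Matrix.scalar V lam - G.walkMatrix B K) b b').det *
        ∏ C : G.Component B, C.graph.cMatrix.charpoly.eval lam := by
  set a' := G.outerMatrix B with ha'
  set S := ∑ r ∈ Finset.range (Nat.card V + 1), (a' * K) ^ r * a' with hS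
  set M := Matrix.scalar V lam - G.cMatrix with hM
  -- The sum is split at its bottom term to compute `M * (1 + K * S)`, and in `hS2` at its top term,
  -- which vanishes on rows outside `B`. There the walk matrix and `S` then cancel in `hMZ`.
  have hS1 : G.walkMatrix B K = a' + a' * K * S := by
    rw [walkMatrix, Finset.sum_range_succ', hS, Finset.mul_sum, pow_zero, one_mul, add_comm]
    congr 1
    exact Finset.sum_congr rfl fun r _ => by rw [pow_succ', mul_assoc]
  have hS2 : G.walkMatrix B K = S + (a' * K) ^ (Nat.card V + 1) * a' := by
    rw [walkMatrix, Finset.sum_range_succ]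
  have hMZ : M * (1 + K * S) = Matrix.scalar V lam - G.innerMatrix B - G.walkMatrix B K +
      (Matrix.diagonal fun x => if x ∈ B then (0 : ℂ) else 1) * S := by
    rw [← hK.scalar_sub_mul, hM, ← innerMatrix_add_outerMatrix (B := B), hS1, ← ha']
    noncomm_ring
  have hcol : ∀ x, ∀ b ∈ B, G.innerMatrix B x b = 0 := fun x b hb => by
    rw [innerMatrix, Matrix.of_apply, if_neg fun h => h.right_not_mem hb]
  let e : B ⊕ ↥Bᶜ ≃ V := Equiv.Set.sumCompl B
  have hmul : M.submatrix e e * (1 + K * S).submatrix e (Subtype.val : B → V) =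
      (M * (1 + K * S)).submatrix e Subtype.val := Matrix.submatrix_mul_equiv _ _ _ _ _
  have key := Matrix.det_eq_det_mul_det_of_solution (M.submatrix e e)
    ((1 + K * S).submatrix e (Subtype.val : B → V)) ?_ ?_
  · rw [Matrix.det_submatrix_equiv_self] at key
    rw [Matrix.eval_charpoly, ← hM, key]
    congr 1
    · congr 1
      ext b b'
      have : e (.inl b) = b := rfl
      rw [Matrix.of_apply, Matrix.of_apply, hmul, Matrix.submatrix_apply, hMZ, this]
      simp [hcol b b' b'.2, Matrix.diagonal_mul]
    · have h2 : (M.submatrix e e).toBlocks₂₂ =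
          Matrix.scalar (↥Bᶜ) lam - (G.restrict Bᶜ).cMatrix := by
        rw [cMatrix_restrict]
        ext u v
        have h3 : ∀ u, e (.inr u) = u := fun _ => rfl
        simp [Matrix.toBlocks₂₂, hM, h3, Matrix.diagonal_apply, Subtype.ext_iff]
      rw [h2, ← Matrix.eval_charpoly, charpoly_eq_prod_scc, Polynomial.eval_prod]
      rfl
  · intro b b'
    have : e (.inl b) = b := rfl
    rw [Matrix.submatrix_apply, this, Matrix.add_apply, Matrix.mul_apply]
    simp [hK.apply_eq_zero b.2, Matrix.one_apply, Subtype.ext_iff]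
  · intro t b
    have h3 : e (.inr t) = t := rfl
    rw [hmul, Matrix.submatrix_apply, hMZ, hS2, h3]
    have h4 : ((a' * K) ^ (Nat.card V + 1) * a') t b = 0 := by
      rw [Matrix.mul_apply]
      refine Finset.sum_eq_zero fun y _ => ?_
      by_contra hne
      have := (hK.outerMatrix_mul_pow_apply _ t.2 (left_ne_zero_of_mul hne)).2
      have := outerHeight_le (G := G) (B := B) (t : V)
      omega
    have htb : (t : V) ≠ b := fun h => t.2 (h ▸ b.2)
    have htB : (t : V) ∉ B := t.2
    rw [Matrix.add_apply, Matrix.sub_apply, Matrix.sub_apply, Matrix.add_apply, h4,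
      Matrix.diagonal_mul, if_neg htB, hcol t b b.2, Matrix.scalar_apply,
      Matrix.diagonal_apply_ne _ htb]
    ring

end Schur

end WeightedDigraph

/-! ### Walk weights as sums over branches -/

namespace WeightedDigraph

section PathWeight

variable {V : Type*}

/-- The weight of the walk that passes through the steps `a` from `s k` to `t k`, and through
the steps `K` from `t k` to `s (k + 1)`. -/
noncomputable def pathWeight (a K : Matrix V V ℂ) {r : ℕ} (s t : Fin (r + 1) → V) : ℂ :=
  (∏ k, a (t k) (s k)) * ∏ k : Fin r, K (s k.succ) (t k.castSucc)

theorem pathWeight_cons (a K : Matrix V V ℂ) {r : ℕ} (x y : V) (s t : Fin (r + 1) → V) :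
    pathWeight a K (Fin.cons x s : Fin (r + 2) → V) (Fin.cons y t : Fin (r + 2) → V) =
      pathWeight a K s t * (K (s 0) y * a y x) := by
  simp only [pathWeight, Fin.prod_univ_succ, Fin.cons_zero, Fin.cons_succ, Fin.castSucc_zero,
    ← Fin.succ_castSucc]
  ring

open scoped Classical in
theorem pow_mul_apply_eq_sum_pathWeight [Fintype V] (a K : Matrix V V ℂ) (r : ℕ) (w v : V) :
    ((a * K) ^ r * a) w v = ∑ s : Fin (r + 1) → V, ∑ t : Fin (r + 1) → V,
      if s 0 = v ∧ t (Fin.last r) = w then pathWeight a K s t else 0 := by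
  induction r generalizing v with
  | zero =>
    rw [← (Equiv.funUnique (Fin 1) V).symm.sum_comp, Finset.sum_eq_single v,
      ← (Equiv.funUnique (Fin 1) V).symm.sum_comp, Finset.sum_eq_single w]
    · simp [pathWeight]
    · intro b _ hb
      simp [hb]
    · simp
    · intro b _ hb
      simp [hb]
    · simp
  | succ r ih =>
    rw [← (Fin.consEquiv fun _ => V).sum_comp, Fintype.sum_prod_type]
    rw [Finset.sum_eq_single v]
    · have hR : ∀ s : Fin (r + 1) → V, (∑ t : Fin (r + 2) → V,
          if (Fin.consEquiv fun _ => V) (v, s) 0 = v ∧ t (Fin.last (r + 1)) = w then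
            pathWeight a K ((Fin.consEquiv fun _ => V) (v, s)) t else 0) =
          ∑ y, ∑ t : Fin (r + 1) → V, if t (Fin.last r) = w then
            pathWeight a K s t * (K (s 0) y * a y v) else 0 := by
        intro s
        rw [← (Fin.consEquiv fun _ => V).sum_comp, Fintype.sum_prod_type]
        refine Finset.sum_congr rfl fun y _ => Finset.sum_congr rfl fun t _ => ?_
        rw [← pathWeight_cons]
        simp [Fin.consEquiv, ← Fin.succ_last]
      rw [Finset.sum_congr rfl fun s _ => hR s]
      -- The rightmost factor is the first edge of the walk, so the induction peels off the start.
      have hL : (a * K) ^ (r + 1) * a = ((a * K) ^ r * a) * (K * a) := by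
        rw [pow_succ]
        simp only [Matrix.mul_assoc]
      rw [hL, Matrix.mul_apply]
      simp_rw [ih, Finset.sum_mul]
      rw [Finset.sum_comm]
      refine Finset.sum_congr rfl fun s _ => ?_
      rw [Finset.sum_eq_single (s 0)]
      · rw [Finset.sum_comm]
        refine Finset.sum_congr rfl fun t _ => ?_
        by_cases ht : t (Fin.last r) = w
        · simp [ht, Matrix.mul_apply, Finset.mul_sum]
        · simp [ht]
      · intro x _ hx
        exact Finset.sum_eq_zero fun t _ => by simp [hx.symm]
      · simp
    · intro x _ hx
      exact Finset.sum_eq_zero fun s _ => Finset.sum_eq_zero fun t _ =>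
        if_neg fun h => hx (by simpa [Fin.consEquiv] using h.1)
    · simp

end PathWeight

variable {V : Type*} {G : WeightedDigraph V} {B : Set V}

namespace ComponentBranch

theorem ext_of_seq {β β' : G.ComponentBranch B}
    (h : (⟨β.length, β.src, β.tgt⟩ : Σ m : ℕ, (Fin (m + 1) → V) × (Fin (m + 1) → V)) =
      ⟨β'.length, β'.src, β'.tgt⟩) : β = β' := by
  rcases β with ⟨m, c, s, t, h1, h2, h3, h4, h5, h6⟩
  rcases β' with ⟨m', c', s', t', h1', h2', h3', h4', h5', h6'⟩
  simp only [Sigma.mk.injEq] at h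
  obtain ⟨rfl, h⟩ := h
  simp only [heq_eq_eq, Prod.mk.injEq] at h
  obtain ⟨rfl, rfl⟩ := h
  obtain rfl : c = c' := funext fun k => Component.eq_of_mem_support (h4 k) (h4' k)
  rfl

/-- Otherwise two consecutive components would coincide, against injectivity, or a component would
meet `B`. -/
theorem not_sameComp (β : G.ComponentBranch B) (k : Fin (β.length + 1)) :
    ¬ G.SameComp B (β.src k) (β.tgt k) := by
  intro h
  induction k using Fin.cases with
  | zero => exact h.left_not_mem β.src_zero_mem
  | succ l =>
    have h1 := h.mem_support (β.src_succ_mem l)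
    obtain ⟨j, hj⟩ | hlast := Fin.eq_castSucc_or_eq_last l.succ
    · rw [hj] at h1
      have := β.comp_injective (Component.eq_of_mem_support h1 (β.tgt_castSucc_mem j))
      subst this
      have := congrArg Fin.val hj
      simp at this
    · rw [hlast] at h1
      exact Component.not_mem_of_mem_support h1 β.tgt_last_mem

variable [Finite V]

/-- A branch is determined by the edges on it which are not inside a component. -/
noncomputable def ofSeq (r : ℕ) (s t : Fin (r + 1) → V) (hadj : ∀ k, G.Adj (s k) (t k))
    (hout : ∀ k, ¬ G.SameComp B (s k) (t k))
    (hsc : ∀ k : Fin r, G.SameComp B (s k.succ) (t k.castSucc))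
    (h0 : s 0 ∈ B) (hlast : t (Fin.last r) ∈ B) : G.ComponentBranch B where
  length := r
  comp k := (hsc k).choose
  src := s
  tgt := t
  comp_injective := by
    -- Distinctness is automatic: each outer edge raises the height, which is constant on
    -- components.
    suffices hm : StrictMono fun k : Fin r => G.outerHeight B (t k.castSucc) by
      intro i j hij
      refine hm.injective (SameComp.outerHeight_eq ⟨_, (hsc i).choose_spec.2, ?_⟩)
      have hij' : (hsc i).choose = (hsc j).choose := hij
      rw [hij']
      exact (hsc j).choose_spec.2
    rcases r with _ | r
    · exact fun i => i.elim0
    · refine Fin.strictMono_iff_lt_succ.2 fun i => ?_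
      have h1 := (hsc i.castSucc).symm.outerHeight_eq
      rw [h1, ← Fin.succ_castSucc]
      refine outerHeight_lt (hadj _) (hsc i.castSucc).left_not_mem ?_ (hout _)
      rw [Fin.succ_castSucc]
      exact (hsc i.succ).right_not_mem
  adj := hadj
  src_zero_mem := h0
  src_succ_mem k := (hsc k).choose_spec.1
  tgt_castSucc_mem k := (hsc k).choose_spec.2
  tgt_last_mem := hlast

theorem length_lt (β : G.ComponentBranch B) : β.length < Nat.card V + 2 := by
  have h1 := Nat.card_le_card_of_injective _ β.comp_injective
  have h2 : Nat.card (G.Component B) ≤ Nat.card V :=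
    Nat.card_le_card_of_injective (fun C => (C.2.nonempty.some : V)) fun C C' h => by
      refine Component.eq_of_mem_support (x := C.2.nonempty.some)
        ⟨_, C.2.nonempty.some_mem, rfl⟩ ?_
      exact ⟨_, C'.2.nonempty.some_mem, h.symm⟩
  rw [Nat.card_fin] at h1
  omega

end ComponentBranch

noncomputable instance [Finite V] : Fintype (G.ComponentBranch B) := Fintype.ofFinite _

-- A sequence of edges with nonzero weight is a branch: `K ≠ 0` forces consecutive ends into one
-- component, and nonzero outer entries are edges not inside a component. The cut-off loses no
-- branch by `length_lt`.
open scoped Classical in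
theorem IsBlockResolvent.walkMatrix_apply [Fintype V] {lam : ℂ} {K : Matrix V V ℂ}
    (hK : G.IsBlockResolvent B lam K) {w v : V} (hw : w ∈ B) (hv : v ∈ B) :
    G.walkMatrix B K w v = ∑ β : G.ComponentBranch B,
      if β.src 0 = v ∧ β.tgt (Fin.last β.length) = w then
        pathWeight G.cMatrix K β.src β.tgt else 0 := by
  rw [walkMatrix, Matrix.sum_apply, Finset.sum_range]
  simp_rw [pow_mul_apply_eq_sum_pathWeight, ← Fintype.sum_prod_type']
  rw [← Fintype.sum_sigma']
  symm
  refine Fintype.sum_of_injective (fun β : G.ComponentBranch B =>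
    (⟨⟨β.length, β.length_lt⟩, β.src, β.tgt⟩ : Σ r : Fin (Nat.card V + 2),
      (Fin (r + 1) → V) × (Fin (r + 1) → V))) ?_ _ _ ?_ ?_
  · intro β β' h
    apply ComponentBranch.ext_of_seq
    exact congrArg (fun p : Σ r : Fin (Nat.card V + 2), (Fin (r + 1) → V) × (Fin (r + 1) → V) =>
      (⟨p.1, p.2⟩ : Σ m : ℕ, (Fin (m + 1) → V) × (Fin (m + 1) → V))) h
  · rintro ⟨⟨r, hr⟩, s, t⟩ hst
    by_contra hne
    obtain ⟨⟨h0, hl⟩, hne⟩ := ite_ne_right_iff.1 hne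
    have h1 : ∀ k, G.outerMatrix B (t k) (s k) ≠ 0 := fun k =>
      Finset.prod_ne_zero_iff.1 (left_ne_zero_of_mul hne) k (Finset.mem_univ k)
    have h2 : ∀ k : Fin r, K (s k.succ) (t k.castSucc) ≠ 0 := fun k =>
      Finset.prod_ne_zero_iff.1 (right_ne_zero_of_mul hne) k (Finset.mem_univ k)
    have h3 : ∀ k, ¬ G.SameComp B (t k) (s k) ∧ G.cMatrix (t k) (s k) ≠ 0 := fun k => by
      have := h1 k
      rw [outerMatrix, Matrix.of_apply] at this
      exact ⟨(ite_ne_left_iff.1 this).1, (ite_ne_left_iff.1 this).2.symm⟩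
    exact hst ⟨ComponentBranch.ofSeq r s t (fun k => adj_of_cMatrix_ne_zero (h3 k).2)
      (fun k h => (h3 k).1 h.symm) (fun k => hK.sameComp (h2 k)) 
      (Set.mem_of_eq_of_mem h0 hv) (Set.mem_of_eq_of_mem hl hw), rfl⟩
  · intro β
    have : pathWeight (G.outerMatrix B) K β.src β.tgt = pathWeight G.cMatrix K β.src β.tgt := by
      unfold pathWeight
      congr 1
      refine Finset.prod_congr rfl fun k _ => ?_
      rw [outerMatrix, Matrix.of_apply, if_neg fun h => β.not_sameComp k h.symm]
    rw [this]

end WeightedDigraph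

/-! ### Schur complement of the specialization -/

namespace WeightedDigraph

section PartialWeight

variable {V : Type*}

/-- The weights of the initial segments of a walk, multiplied by `c`. -/
noncomputable def partialWeight (a K : Matrix V V ℂ) (c : ℂ) {r : ℕ} (s t : Fin (r + 1) → V) :
    Fin (r + 1) → ℂ :=
  Fin.induction (a (t 0) (s 0) * c)
    fun l p => a (t l.succ) (s l.succ) * (K (s l.succ) (t l.castSucc) * p)

theorem partialWeight_zero (a K : Matrix V V ℂ) (c : ℂ) {r : ℕ} (s t : Fin (r + 1) → V) :
    partialWeight a K c s t 0 = a (t 0) (s 0) * c := rfl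

theorem partialWeight_succ (a K : Matrix V V ℂ) (c : ℂ) {r : ℕ} (s t : Fin (r + 1) → V)
    (l : Fin r) : partialWeight a K c s t l.succ =
      a (t l.succ) (s l.succ) *
        (K (s l.succ) (t l.castSucc) * partialWeight a K c s t l.castSucc) :=
  Fin.induction_succ _ _ _

theorem partialWeight_castSucc (a K : Matrix V V ℂ) (c : ℂ) {r : ℕ} (s t : Fin (r + 2) → V)
    (k : Fin (r + 1)) : partialWeight a K c s t k.castSucc =
      partialWeight a K c (fun k => s k.castSucc) (fun k => t k.castSucc) k := by
  induction k using Fin.induction with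
  | zero => rfl
  | succ l ih => rw [← Fin.succ_castSucc, partialWeight_succ, partialWeight_succ, ih]; rfl

theorem partialWeight_last (a K : Matrix V V ℂ) (c : ℂ) {r : ℕ} (s t : Fin (r + 1) → V) :
    partialWeight a K c s t (Fin.last r) = pathWeight a K s t * c := by
  induction r with
  | zero => simp [pathWeight, partialWeight_zero]
  | succ r ih =>
    rw [← Fin.succ_last, partialWeight_succ, partialWeight_castSucc, ih, pathWeight, pathWeight,
      Fin.prod_univ_castSucc (n := r + 1)]
    simp only [Fin.prod_univ_castSucc (n := r), Fin.succ_last, Fin.succ_castSucc]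
    ring

end PartialWeight

variable {V : Type*} {G : WeightedDigraph V} {B : Set V}

namespace ComponentBranch

/-- The vertex of the specialization at which the edge `e_k` of the branch begins. -/
noncomputable def srcVertex (β : G.ComponentBranch B) : Fin (β.length + 1) → G.SpecVertex B :=
  Fin.cases (.inl ⟨β.src 0, β.src_zero_mem⟩) fun l =>
    .inr ⟨β, l, ⟨(β.src_succ_mem l).choose, (β.src_succ_mem l).choose_spec.1⟩⟩

theorem srcVertex_zero (β : G.ComponentBranch B) :
    β.srcVertex 0 = .inl ⟨β.src 0, β.src_zero_mem⟩ := rfl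

theorem srcVertex_succ (β : G.ComponentBranch B) (l : Fin β.length) :
    ∃ u : (β.comp l).1, β.srcVertex l.succ = .inr ⟨β, l, u⟩ ∧ (u : V) = β.src l.succ :=
  ⟨_, rfl, (β.src_succ_mem l).choose_spec.2⟩

theorem isSrc_iff {β : G.ComponentBranch B} {k : Fin (β.length + 1)} {x : G.SpecVertex B} :
    β.IsSrc k x ↔ x = β.srcVertex k := by
  induction k using Fin.cases with
  | zero =>
    rw [srcVertex_zero]
    constructor
    · rintro ⟨h, ⟨_, b, rfl⟩ | ⟨l, _, h', _⟩⟩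
      · exact congrArg Sum.inl (Subtype.ext h)
      · exact absurd h'.symm (Fin.succ_ne_zero l)
    · rintro rfl
      exact ⟨rfl, Or.inl ⟨rfl, _, rfl⟩⟩
  | succ l =>
    obtain ⟨u, hu, hu'⟩ := β.srcVertex_succ l
    rw [hu]
    constructor
    · rintro ⟨h, ⟨h', _⟩ | ⟨l', u', h', rfl⟩⟩
      · exact absurd h' (Fin.succ_ne_zero l)
      · obtain rfl := Fin.succ_injective _ h'
        obtain rfl : u' = u := Component.coe_injective _ (h.trans hu'.symm)
        rfl
    · rintro rfl
      exact ⟨hu', Or.inr ⟨l, u, rfl, rfl⟩⟩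

theorem isTgt_inl_iff {β : G.ComponentBranch B} {k : Fin (β.length + 1)} {b : B} :
    β.IsTgt k (.inl b) ↔ k = Fin.last β.length ∧ β.tgt (Fin.last β.length) = b := by
  constructor
  · rintro ⟨h, ⟨rfl, _⟩ | ⟨l, u, _, h'⟩⟩
    · exact ⟨rfl, h.symm⟩
    · cases h'
  · rintro ⟨rfl, h⟩
    exact ⟨h.symm, Or.inl ⟨rfl, b, rfl⟩⟩

theorem isTgt_inr_iff {β β' : G.ComponentBranch B} {k : Fin (β'.length + 1)} {l : Fin β.length}
    {u : (β.comp l).1} :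
    β'.IsTgt k (.inr ⟨β, l, u⟩) ↔
      ∃ h : β = β', k = (l.cast (congrArg _ h)).castSucc ∧ (u : V) = β.tgt l.castSucc := by
  constructor
  · rintro ⟨h, ⟨_, _, h'⟩ | ⟨l', u', rfl, h'⟩⟩
    · cases h'
    · cases h'
      exact ⟨rfl, rfl, h⟩
  · rintro ⟨rfl, rfl, h⟩
    exact ⟨h, Or.inr ⟨l, u, rfl, rfl⟩⟩

theorem srcVertex_castSucc_ne {β : G.ComponentBranch B} (l : Fin β.length)
    (u : (β.comp l).1) : β.srcVertex l.castSucc ≠ .inr ⟨β, l, u⟩ := by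
  intro h
  obtain h0 | ⟨j, hj⟩ := Fin.eq_zero_or_eq_succ l.castSucc
  · rw [h0, srcVertex_zero] at h
    cases h
  · obtain ⟨v, hv, _⟩ := β.srcVertex_succ j
    rw [hj, hv] at h
    cases h
    have := congrArg Fin.val hj
    simp at this

/-- A final edge that begins in a copy reveals its branch through that copy; one that begins in `B`
is the whole branch. Hence the edges into a vertex of `B` are counted by the branches ending there.
-/
theorem eq_of_srcVertex_last_eq {β β' : G.ComponentBranch B}
    (h : β.srcVertex (Fin.last _) = β'.srcVertex (Fin.last _))
    (ht : β.tgt (Fin.last _) = β'.tgt (Fin.last _)) : β = β' := by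
  obtain h0 | ⟨j, hj⟩ := Fin.eq_zero_or_eq_succ (Fin.last β.length)
  · obtain h0' | ⟨j', hj'⟩ := Fin.eq_zero_or_eq_succ (Fin.last β'.length)
    · rw [h0, h0', srcVertex_zero, srcVertex_zero] at h
      have hs : β.src 0 = β'.src 0 := congrArg Subtype.val (Sum.inl_injective h)
      rw [h0, h0'] at ht
      have hl : β.length = 0 := congrArg Fin.val h0
      have hl' : β'.length = 0 := congrArg Fin.val h0'
      apply ext_of_seq
      clear h h0 h0'
      generalize β.src = s, β'.src = s', β.tgt = t, β'.tgt = t' at hs ht ⊢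
      generalize β.length = m, β'.length = m' at hl hl' s s' t t' hs ht ⊢
      subst hl hl'
      congr 2
      · exact funext fun k => by rwa [show k = 0 from Fin.ext (by omega)]
      · exact funext fun k => by rwa [show k = 0 from Fin.ext (by omega)]
    · obtain ⟨v, hv, _⟩ := β'.srcVertex_succ j'
      rw [h0, hj', hv, srcVertex_zero] at h
      cases h
  · obtain ⟨v, hv, _⟩ := β.srcVertex_succ j
    rw [hj, hv] at h
    obtain h0' | ⟨j', hj'⟩ := Fin.eq_zero_or_eq_succ (Fin.last β'.length)
    · rw [h0', srcVertex_zero] at h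
      cases h
    · obtain ⟨v', hv', _⟩ := β'.srcVertex_succ j'
      rw [hj', hv'] at h
      cases h
      rfl

end ComponentBranch

open ComponentBranch

theorem adj_inl_iff {Y : G.SpecVertex B} {b : B} :
    (G.specialization B).Adj Y (.inl b) ↔
      ∃ β : G.ComponentBranch B, β.tgt (Fin.last _) = b ∧ Y = β.srcVertex (Fin.last _) := by
  constructor
  · rintro ⟨β, ⟨_, _, _, _, h, _⟩ | ⟨k, h1, h2⟩⟩
    · cases h
    · obtain ⟨rfl, h⟩ := isTgt_inl_iff.1 h2
      exact ⟨β, h, isSrc_iff.1 h1⟩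
  · rintro ⟨β, h, rfl⟩
    exact ⟨β, Or.inr ⟨_, isSrc_iff.2 rfl, isTgt_inl_iff.2 ⟨rfl, h⟩⟩⟩

theorem adj_inr_iff {Y : G.SpecVertex B} {β : G.ComponentBranch B} {l : Fin β.length}
    {x : (β.comp l).1} :
    (G.specialization B).Adj Y (.inr ⟨β, l, x⟩) ↔
      (∃ u : (β.comp l).1, Y = .inr ⟨β, l, u⟩ ∧ G.Adj u x) ∨
        (Y = β.srcVertex l.castSucc ∧ (x : V) = β.tgt l.castSucc) := by
  constructor
  · rintro ⟨β', ⟨k, u, v, rfl, h, huv⟩ | ⟨k, h1, h2⟩⟩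
    · cases h
      exact Or.inl ⟨u, rfl, huv⟩
    · obtain ⟨rfl, rfl, h⟩ := isTgt_inr_iff.1 h2
      exact Or.inr ⟨isSrc_iff.1 h1, h⟩
  · rintro (⟨u, rfl, h⟩ | ⟨rfl, h⟩)
    · exact ⟨β, Or.inl ⟨l, u, x, rfl, rfl, h⟩⟩
    · exact ⟨β, Or.inr ⟨_, isSrc_iff.2 rfl, isTgt_inr_iff.2 ⟨rfl, rfl, h⟩⟩⟩

open scoped Classical in
theorem cMatrix_specialization_apply (X Y : G.SpecVertex B) :
    (G.specialization B).cMatrix X Y =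
      if (G.specialization B).Adj Y X then G.cMatrix X.orig Y.orig else 0 := by
  by_cases h : (G.specialization B).Adj Y X
  · have h' : G.Adj Y.orig X.orig := h.elim fun _ hβ => hβ.orig_adj
    rw [if_pos h]
    simp only [cMatrix, adjMatrix, Matrix.map_apply, Matrix.of_apply, dif_pos h, dif_pos h']
    rfl
  · rw [if_neg h]
    simp [cMatrix, adjMatrix, h]

theorem orig_srcVertex (β : G.ComponentBranch B) (k : Fin (β.length + 1)) :
    (β.srcVertex k).orig = β.src k :=
  (isSrc_iff.2 rfl : β.IsSrc k _).1

open scoped Classical in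
theorem sum_specialization_inl [Fintype V] (f : G.SpecVertex B → ℂ) (b : B) :
    ∑ Y, (G.specialization B).cMatrix (.inl b) Y * f Y =
      ∑ β : G.ComponentBranch B, if β.tgt (Fin.last _) = b then
        G.cMatrix (β.tgt (Fin.last _)) (β.src (Fin.last _)) * f (β.srcVertex (Fin.last _))
        else 0 := by
  rw [← Finset.sum_filter]
  symm
  refine Finset.sum_of_injOn (fun β => β.srcVertex (Fin.last _)) ?_ (fun _ _ => by simp) ?_ ?_
  · intro β hβ β' hβ' h
    simp only [Finset.coe_filter, Finset.mem_univ, true_and, Set.mem_ofPred_eq] at hβ hβ'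
    exact eq_of_srcVertex_last_eq h (hβ.trans hβ'.symm)
  · intro Y _ hY
    rw [cMatrix_specialization_apply, if_neg, zero_mul]
    intro h
    obtain ⟨β, h1, h2⟩ := adj_inl_iff.1 h
    exact hY ⟨β, by simpa using h1, h2.symm⟩
  · intro β hβ
    have h1 : β.tgt (Fin.last _) = b := by simpa using hβ
    rw [cMatrix_specialization_apply, if_pos (adj_inl_iff.2 ⟨β, h1, rfl⟩), orig_srcVertex, h1]
    rfl

-- A vertex in a copy receives edges only from its own copy and, if it is the entry vertex, from the
-- preceding vertex of the branch.
open scoped Classical in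
theorem sum_specialization_inr [Fintype V] (f : G.SpecVertex B → ℂ) (β : G.ComponentBranch B)
    (l : Fin β.length) (x : (β.comp l).1) :
    ∑ Y, (G.specialization B).cMatrix (.inr ⟨β, l, x⟩) Y * f Y =
      ∑ u : (β.comp l).1, G.cMatrix x u * f (.inr ⟨β, l, u⟩) +
        if (x : V) = β.tgt l.castSucc then
          G.cMatrix (β.tgt l.castSucc) (β.src l.castSucc) * f (β.srcVertex l.castSucc)
        else 0 := by
  have h1 : ∑ u : (β.comp l).1, G.cMatrix x u * f (.inr ⟨β, l, u⟩) =
      ∑ Y : G.SpecVertex B, if ∃ u : (β.comp l).1, Y = .inr ⟨β, l, u⟩ then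
        G.cMatrix x Y.orig * f Y else 0 := by
    refine Fintype.sum_of_injective (fun u => (.inr ⟨β, l, u⟩ : G.SpecVertex B)) ?_ _ _ ?_ ?_
    · intro u v h
      cases h
      rfl
    · intro Y hY
      exact if_neg fun ⟨u, hu⟩ => hY ⟨u, hu.symm⟩
    · intro u
      rw [if_pos ⟨u, rfl⟩]
      rfl
  have h2 : (if (x : V) = β.tgt l.castSucc then
      G.cMatrix (β.tgt l.castSucc) (β.src l.castSucc) * f (β.srcVertex l.castSucc) else 0) =
      ∑ Y : G.SpecVertex B, if Y = β.srcVertex l.castSucc ∧ (x : V) = β.tgt l.castSucc then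
        G.cMatrix x Y.orig * f Y else 0 := by
    rw [Finset.sum_eq_single (β.srcVertex l.castSucc)]
    · by_cases h : (x : V) = β.tgt l.castSucc
      · simp [h, orig_srcVertex]
      · simp [h]
    · intro Y _ hY
      exact if_neg fun h => hY h.1
    · simp
  rw [h1, h2, ← Finset.sum_add_distrib]
  refine Finset.sum_congr rfl fun Y _ => ?_
  rw [cMatrix_specialization_apply]
  by_cases hP : ∃ u : (β.comp l).1, Y = .inr ⟨β, l, u⟩
  · have hQ : ¬ (Y = β.srcVertex l.castSucc ∧ (x : V) = β.tgt l.castSucc) := by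
      rintro ⟨rfl, _⟩
      obtain ⟨u, hu⟩ := hP
      exact srcVertex_castSucc_ne l u hu
    rw [if_pos hP, if_neg hQ, add_zero]
    obtain ⟨u, rfl⟩ := hP
    by_cases hadj : G.Adj u x
    · rw [if_pos (adj_inr_iff.2 (Or.inl ⟨u, rfl, hadj⟩))]
      rfl
    · have h0 : G.cMatrix x u = 0 := by
        by_contra hne
        exact hadj (adj_of_cMatrix_ne_zero hne)
      change (if _ then G.cMatrix x u else 0) * _ = G.cMatrix x u * _
      rw [h0, ite_self]
  · rw [if_neg hP, zero_add]
    have hiff : (G.specialization B).Adj Y (.inr ⟨β, l, x⟩) ↔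
        (Y = β.srcVertex l.castSucc ∧ (x : V) = β.tgt l.castSucc) := by
      rw [adj_inr_iff]
      exact or_iff_right fun ⟨u, hu, _⟩ => hP ⟨u, hu⟩
    rw [if_congr hiff rfl rfl, ite_mul, zero_mul]
    rfl

open scoped Classical in
/-- The vector of walk weights in the specialization, for walks that begin at `v`. -/
noncomputable def specSolution (K : Matrix V V ℂ) (v : B) : G.SpecVertex B → ℂ
  | .inl b => if b = v then 1 else 0
  | .inr ⟨β, l, x⟩ => K x (β.tgt l.castSucc) *
      partialWeight G.cMatrix K (if β.src 0 = v then 1 else 0) β.src β.tgt l.castSucc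

-- The recursion for partial weights is the propagation of the solution along the branch; `c` is `0`
-- on branches that do not begin at `v`.
open scoped Classical in
theorem partialWeight_eq_specSolution (K : Matrix V V ℂ) (v : B) (β : G.ComponentBranch B)
    (k : Fin (β.length + 1)) :
    partialWeight G.cMatrix K (if β.src 0 = v then 1 else 0) β.src β.tgt k =
      G.cMatrix (β.tgt k) (β.src k) * specSolution K v (β.srcVertex k) := by
  induction k using Fin.cases with
  | zero =>
    rw [partialWeight_zero, srcVertex_zero]
    simp [specSolution, Subtype.ext_iff]
  | succ l =>
    obtain ⟨u, hu, hu'⟩ := β.srcVertex_succ l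
    rw [partialWeight_succ, hu, ← hu']
    rfl

-- Off `B`, an edge between different copies leads to the next position of the same branch, so the
-- position serves as height.
open scoped Classical in
theorem charpoly_specialization_block [Fintype V] :
    (((G.specialization B).cMatrix).toBlocks₂₂).charpoly =
      ∏ p : (Σ β : G.ComponentBranch B, Fin β.length),
        (p.1.comp p.2).graph.cMatrix.charpoly := by
  rw [← Matrix.charpoly_reindex (Equiv.sigmaAssoc
      fun (β : G.ComponentBranch B) (k : Fin β.length) => ↥(β.comp k).1).symm,
    Matrix.charpoly_eq_prod_of_height _ (fun p => (p.2 : ℕ))]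
  · refine Finset.prod_congr rfl fun p _ => ?_
    congr 1
    ext u v
    change (G.specialization B).cMatrix (.inr ⟨p.1, p.2, u⟩) (.inr ⟨p.1, p.2, v⟩) = _
    rw [cMatrix_specialization_apply, cMatrix_component, Matrix.submatrix_apply]
    by_cases h : G.Adj v u
    · rw [if_pos (adj_inr_iff.2 (Or.inl ⟨v, rfl, h⟩))]
      rfl
    · have h0 : G.cMatrix u v = 0 := by
        by_contra hne
        exact h (adj_of_cMatrix_ne_zero hne)
      rw [h0]
      exact ite_eq_right_iff.2 fun _ => h0
  · rintro ⟨⟨β, l⟩, u⟩ ⟨⟨β', l'⟩, u'⟩ hne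
    have hadj : (G.specialization B).Adj (.inr ⟨β', l', u'⟩) (.inr ⟨β, l, u⟩) :=
      adj_of_cMatrix_ne_zero hne
    rcases adj_inr_iff.1 hadj with ⟨v, h, _⟩ | ⟨h, _⟩
    · cases h
      exact Or.inl rfl
    · right
      obtain h0 | ⟨j, hj⟩ := Fin.eq_zero_or_eq_succ l.castSucc
      · rw [h0, srcVertex_zero] at h
        cases h
      · obtain ⟨v, hv, _⟩ := β.srcVertex_succ j
        rw [hj, hv] at h
        cases h
        have := congrArg Fin.val hj
        simp only [Fin.val_castSucc, Fin.val_succ] at this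
        change (j : ℕ) < l
        omega

open scoped Classical in
theorem prod_branch_eq_prod_pow {M : Type*} [CommMonoid M] [Fintype V] (f : G.Component B → M) :
    ∏ p : (Σ β : G.ComponentBranch B, Fin β.length), f (p.1.comp p.2) =
      ∏ C : G.Component B, f C ^ G.numCopies B C := by
  rw [← Finset.prod_fiberwise _ fun p : (Σ β : G.ComponentBranch B, Fin β.length) =>
    p.1.comp p.2]
  refine Finset.prod_congr rfl fun C _ => ?_
  rw [Finset.prod_congr rfl fun p hp => by rw [(Finset.mem_filter.1 hp).2], Finset.prod_const,
    numCopies, Nat.card_eq_fintype_card, Fintype.card_subtype]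

open scoped Classical in
/-- The Schur complement formula for the characteristic polynomial of the specialization. -/
theorem IsBlockResolvent.eval_charpoly_specialization [Fintype V] {lam : ℂ} {K : Matrix V V ℂ}
    (hK : G.IsBlockResolvent B lam K) :
    (G.specialization B).cMatrix.charpoly.eval lam =
      (Matrix.of fun b b' : B => (Matrix.scalar V lam - G.walkMatrix B K) b b').det *
        ∏ C : G.Component B, C.graph.cMatrix.charpoly.eval lam ^ G.numCopies B C := by
  set M := Matrix.scalar (G.SpecVertex B) lam - (G.specialization B).cMatrix with hM
  let Z : Matrix (G.SpecVertex B) B ℂ := Matrix.of fun X v => specSolution K v X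
  have hMZ : ∀ X v, (M * Z) X v = lam * specSolution K v X -
      ∑ Y, (G.specialization B).cMatrix X Y * specSolution K v Y := by
    intro X v
    rw [hM, Matrix.sub_mul, Matrix.sub_apply, Matrix.scalar_apply, Matrix.diagonal_mul,
      Matrix.mul_apply]
    rfl
  have key := Matrix.det_eq_det_mul_det_of_solution M Z ?_ ?_
  · have h2 : M.toBlocks₂₂ =
        Matrix.scalar _ lam - ((G.specialization B).cMatrix).toBlocks₂₂ := by
      ext u v
      simp [Matrix.toBlocks₂₂, hM, Matrix.diagonal_apply]
    have h3 : M.toBlocks₂₂.det =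
        ∏ C : G.Component B, C.graph.cMatrix.charpoly.eval lam ^ G.numCopies B C := by
      rw [h2, ← Matrix.eval_charpoly, charpoly_specialization_block, Polynomial.eval_prod,
        prod_branch_eq_prod_pow fun C : G.Component B => C.graph.cMatrix.charpoly.eval lam]
    rw [Matrix.eval_charpoly, ← hM, key, h3]
    congr 2
    ext b b'
    rw [Matrix.of_apply, Matrix.of_apply, hMZ, sum_specialization_inl, Matrix.sub_apply,
      hK.walkMatrix_apply b.2 b'.2, Matrix.scalar_apply, Matrix.diagonal_apply]
    congr 1
    · simp [specSolution, Subtype.ext_iff]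
    -- The partial weight through the last edge is the full path weight, so both graphs have the
    -- same Schur complement.
    · refine Finset.sum_congr rfl fun β _ => ?_
      rw [← partialWeight_eq_specSolution, partialWeight_last]
      by_cases h1 : β.tgt (Fin.last _) = b <;> by_cases h2 : β.src 0 = b' <;> simp [h1, h2]
  · intro b b'
    simp [Z, specSolution, Matrix.one_apply]
  · rintro ⟨β, l, x⟩ v
    rw [hMZ, sum_specialization_inr, ← partialWeight_eq_specSolution]
    -- The resolvent equation in the column of the entry vertex produces exactly the contribution of
    -- the edge entering the copy.
    have := hK.equation (β.comp l) x (β.tgt l.castSucc)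
    simp only [specSolution, ← mul_assoc, ← Finset.sum_mul]
    rw [← sub_sub, ← sub_mul, this]
    split_ifs <;> simp

end WeightedDigraph

theorem Polynomial.roots_prod_eq_sum {ι : Type*} (s : Finset ι) (f : ι → Polynomial ℂ)
    (h : ∀ i, f i ≠ 0) : (∏ i ∈ s, f i).roots = ∑ i ∈ s, (f i).roots := by
  classical
  induction s using Finset.induction_on with
  | empty => simp
  | insert i s hi ih =>
    rw [Finset.prod_insert hi, Finset.sum_insert hi, Polynomial.roots_mul, ih]
    exact mul_ne_zero (h i) (Finset.prod_ne_zero_iff.2 fun j _ => h j)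

/-! ### Components that lie on no branch -/

namespace WeightedDigraph

variable {V : Type*} {G : WeightedDigraph V} {B : Set V}

variable (G B) in
/-- There is an initial segment of a component branch which leads to the component of `z` and
meets `D`. -/
def BranchPrefix (D : Set V) (z : V) : Prop :=
  ∃ (n : ℕ) (s t : ℕ → V), s 0 ∈ B ∧ (∀ k ≤ n, G.Adj (s k) (t k)) ∧
    (∀ k ≤ n, ¬ G.SameComp B (s k) (t k)) ∧ (∀ k < n, G.SameComp B (s (k + 1)) (t k)) ∧
    G.SameComp B (t n) z ∧ ∃ k ≤ n, t k ∈ D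

theorem BranchPrefix.of_adj {D : Set V} {b z : V} (hb : b ∈ B) (hz : z ∉ B) (h : G.Adj b z)
    (hD : z ∈ D) : G.BranchPrefix B D z :=
  ⟨0, fun _ => b, fun _ => z, hb, fun _ _ => h, fun _ _ h' => h'.left_not_mem hb,
    fun k hk => absurd hk (Nat.not_lt_zero k), sameComp_self hz, 0, le_rfl, hD⟩

/-- The last edge of the prefix ends in the component of `z`, so the prefix itself meets `C`. -/
theorem BranchPrefix.mono_of_mem {D : Set V} {z : V} {C : G.Component B} (hz : z ∈ C.support)
    (h : G.BranchPrefix B D z) : G.BranchPrefix B C.support z := by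
  obtain ⟨n, s, t, h1, h2, h3, h4, h5, _⟩ := h
  exact ⟨n, s, t, h1, h2, h3, h4, h5, n, le_rfl, h5.symm.mem_support hz⟩

/-- A sequence of edges can be prolonged by an edge. -/
theorem exists_snoc_edge {n : ℕ} {s t : ℕ → V} {y z : V} (h1 : s 0 ∈ B)
    (h2 : ∀ k ≤ n, G.Adj (s k) (t k)) (h3 : ∀ k ≤ n, ¬ G.SameComp B (s k) (t k))
    (h4 : ∀ k < n, G.SameComp B (s (k + 1)) (t k)) (h5 : G.SameComp B (t n) y)
    (h : G.Adj y z) (hn : ¬ G.SameComp B y z) :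
    ∃ s' t' : ℕ → V, s' 0 ∈ B ∧ (∀ k ≤ n + 1, G.Adj (s' k) (t' k)) ∧
      (∀ k ≤ n + 1, ¬ G.SameComp B (s' k) (t' k)) ∧
      (∀ k < n + 1, G.SameComp B (s' (k + 1)) (t' k)) ∧ (∀ k ≤ n, t' k = t k) ∧
      t' (n + 1) = z := by
  refine ⟨fun k => if k ≤ n then s k else y, fun k => if k ≤ n then t k else z, by simpa using h1,
    fun k hk => ?_, fun k hk => ?_, fun k hk => ?_, fun k hk => if_pos hk, if_neg (by omega)⟩
  · by_cases hk' : k ≤ n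
    · simpa [hk'] using h2 k hk'
    · simpa [hk'] using h
  · by_cases hk' : k ≤ n
    · simpa [hk'] using h3 k hk'
    · simpa [hk'] using hn
  · by_cases hk' : k < n
    · simpa [hk'.le, Nat.succ_le_of_lt hk'] using h4 k hk'
    · obtain rfl : k = n := by omega
      simpa using h5.symm

/-- An edge inside a component leaves the sequence unchanged; any other edge is appended. -/
theorem BranchPrefix.tail {D : Set V} {y z : V} (hy : G.BranchPrefix B D y) (h : G.Adj y z)
    (hz : z ∉ B) : G.BranchPrefix B D z := by
  obtain ⟨n, s, t, h1, h2, h3, h4, h5, k, hk, hkD⟩ := hy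
  by_cases hyz : G.SameComp B y z
  · exact ⟨n, s, t, h1, h2, h3, h4, h5.trans hyz, k, hk, hkD⟩
  · obtain ⟨s', t', h1', h2', h3', h4', h5', h6'⟩ := exists_snoc_edge h1 h2 h3 h4 h5 h hyz
    exact ⟨n + 1, s', t', h1', h2', h3', h4', h6'.symm ▸ sameComp_self hz, k, by omega,
      (h5' k hk).symm ▸ hkD⟩

theorem BranchPrefix.reflTransGen {D : Set V} {y z : ↥Bᶜ} (hy : G.BranchPrefix B D y)
    (h : Relation.ReflTransGen (G.restrict Bᶜ).Adj y z) : G.BranchPrefix B D z := by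
  induction h with
  | refl => exact hy
  | @tail _ w _ h2 ih => exact ih.tail h2 w.2

theorem BranchPrefix.exists_branch [Finite V] {D : Set V} {y b : V} (hy : G.BranchPrefix B D y)
    (h : G.Adj y b) (hb : b ∈ B) :
    ∃ (β : G.ComponentBranch B) (k : Fin β.length), β.tgt k.castSucc ∈ D := by
  obtain ⟨n, s, t, h1, h2, h3, h4, h5, k, hk, hkD⟩ := hy
  obtain ⟨s', t', h1', h2', h3', h4', h5', h6'⟩ :=
    exists_snoc_edge h1 h2 h3 h4 h5 h fun h => h.right_not_mem hb
  refine ⟨ComponentBranch.ofSeq (n + 1) (fun k => s' k) (fun k => t' k)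
    (fun k => h2' k (by omega)) (fun k => h3' k (by omega)) (fun k => h4' k k.2) h1'
    (Set.mem_of_eq_of_mem h6' hb), ⟨k, by simpa [ComponentBranch.ofSeq] using by omega⟩,
    Set.mem_of_eq_of_mem (h5' k hk) hkD⟩

theorem exists_exit {x : ↥Bᶜ} {z : V} (h : Relation.ReflTransGen G.Adj x z) :
    (∃ z' : ↥Bᶜ, (z' : V) = z ∧ Relation.ReflTransGen (G.restrict Bᶜ).Adj x z') ∨
      ∃ (y : ↥Bᶜ) (b : V), b ∈ B ∧ Relation.ReflTransGen (G.restrict Bᶜ).Adj x y ∧ G.Adj y b := by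
  induction h with
  | refl => exact Or.inl ⟨x, rfl, .refl⟩
  | @tail y z _ hyz ih =>
    rcases ih with ⟨y', rfl, hy⟩ | ih
    · by_cases hz : z ∈ B
      · exact Or.inr ⟨y', z, hz, hy, hyz⟩
      · exact Or.inl ⟨⟨z, hz⟩, rfl, hy.tail hyz⟩
    · exact Or.inr ih

theorem exists_entry {x : ↥Bᶜ} {z : V} (h : Relation.ReflTransGen G.Adj z x) :
    (∃ z' : ↥Bᶜ, (z' : V) = z ∧ Relation.ReflTransGen (G.restrict Bᶜ).Adj z' x) ∨
      ∃ (y : ↥Bᶜ) (b : V), b ∈ B ∧ Relation.ReflTransGen (G.restrict Bᶜ).Adj y x ∧ G.Adj b y := by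
  induction h using Relation.ReflTransGen.head_induction_on with
  | refl => exact Or.inl ⟨x, rfl, .refl⟩
  | @head z y hzy _ ih =>
    rcases ih with ⟨y', rfl, hy⟩ | ih
    · by_cases hz : z ∈ B
      · exact Or.inr ⟨y', z, hz, hy, hzy⟩
      · exact Or.inl ⟨⟨z, hz⟩, rfl, .head hzy hy⟩
    · exact Or.inr ih

/-- Cut the walks from `b` to `x` and from `x` to `b` where they meet `B` next to `x`. Joined and
with the steps inside components dropped, the remaining pieces form a branch through `C`. -/
theorem numCopies_ne_zero [Finite V] {C : G.Component B} {x b : V} (hx : x ∈ C.support)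
    (hb : b ∈ B) (hxb : Relation.ReflTransGen G.Adj x b) (hbx : Relation.ReflTransGen G.Adj b x) :
    G.numCopies B C ≠ 0 := by
  obtain ⟨u, rfl⟩ := Component.exists_eq_of_mem_support hx
  obtain ⟨z, rfl, _⟩ | ⟨y, b', hb', hy, hyb⟩ := exists_exit (x := u.1) hxb
  · exact absurd hb z.2
  obtain ⟨z, rfl, _⟩ | ⟨y', b'', hb'', hy', hby'⟩ := exists_entry (x := u.1) hbx
  · exact absurd hb z.2
  have h1 : G.BranchPrefix B Set.univ u :=
    (BranchPrefix.of_adj hb'' y'.2 hby' (Set.mem_univ _)).reflTransGen hy'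
  obtain ⟨β, k, hk⟩ := ((h1.mono_of_mem hx).reflTransGen hy).exists_branch hyb hb'
  have : Nonempty {p : Σ β : G.ComponentBranch B, Fin β.length // p.1.comp p.2 = C} :=
    ⟨⟨⟨β, k⟩, Component.eq_of_mem_support (β.tgt_castSucc_mem k) hk⟩⟩
  exact Nat.card_pos.ne'

/-- A component that lies on no branch is a strongly connected component of the whole graph. -/
theorem isSCC_support_of_numCopies_eq_zero [Finite V] {C : G.Component B}
    (hC : G.numCopies B C = 0) : G.IsSCC C.support := by
  obtain ⟨x, hx⟩ := C.2.nonempty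
  have hxC : (x : V) ∈ C.support := ⟨x, hx, rfl⟩
  -- The class of `x` in `G` misses `B`, so its internal paths already run in the complement of `B`.
  have hB : ∀ z ∈ G.sccOf x, z ∈ Bᶜ := fun z hz hzB =>
    numCopies_ne_zero hxC hzB hz.1 hz.2 hC
  suffices h : C.support = G.sccOf x from h ▸ isSCC_sccOf _
  have hlift : ∀ {u v : G.sccOf x}, Relation.ReflTransGen (G.restrict (G.sccOf x)).Adj u v →
      Relation.ReflTransGen (G.restrict Bᶜ).Adj ⟨u, hB u u.2⟩ ⟨v, hB v v.2⟩ := fun h =>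
    h.lift (fun u : G.sccOf x => (⟨u, hB u u.2⟩ : ↥Bᶜ)) fun _ _ h => h
  have hconn := (isSCC_sccOf (H := G) (x : V)).prop.2
  apply Set.Subset.antisymm
  · rintro _ ⟨v, hv, rfl⟩
    have := C.2.eq_sccOf hx ▸ hv
    exact ⟨reflTransGen_of_restrict this.1, reflTransGen_of_restrict this.2⟩
  · intro z hz
    refine ⟨⟨z, hB z hz⟩, ?_, rfl⟩
    rw [C.2.eq_sccOf hx]
    exact ⟨hlift (hconn ⟨x, mem_sccOf_self _⟩ ⟨z, hz⟩), hlift (hconn ⟨z, hz⟩ ⟨x, mem_sccOf_self _⟩)⟩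

/-! ### From characteristic polynomials to spectra -/

theorem spectrum_restrict_support [Finite V] (C : G.Component B) :
    (G.restrict C.support).spectrum = C.graph.spectrum := by
  classical
  have := Fintype.ofFinite V
  rw [spectrum_eq_roots, spectrum_eq_roots, cMatrix_component, cMatrix_restrict]
  let e : C.1 ≃ C.support := Equiv.Set.image Subtype.val C.1 Subtype.val_injective
  rw [← Matrix.charpoly_reindex e]
  congr 2
  ext x y
  obtain ⟨u, rfl⟩ := e.surjective x
  obtain ⟨v, rfl⟩ := e.surjective y
  simp only [Matrix.reindex_apply, Matrix.submatrix_apply, Equiv.symm_apply_apply]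
  rfl

open scoped Classical in
theorem spectrum_eq_sum_scc [Fintype V] (H : WeightedDigraph V) :
    H.spectrum = ∑ S : {S : Set V // H.IsSCC S}, (H.restrict S.1).spectrum := by
  rw [spectrum_eq_roots, charpoly_eq_prod_scc,
    Polynomial.roots_prod_eq_sum _ _ fun _ => (Matrix.charpoly_monic _).ne_zero]
  exact Finset.sum_congr rfl fun S _ => (spectrum_eq_roots _).symm

-- The components without copies are distinct strongly connected components of `G`, whose spectrum
-- is the sum over all of these.
open scoped Classical in
theorem sum_spectrum_le [Fintype V] :
    ∑ C : G.Component B, (if G.numCopies B C = 0 then C.graph.spectrum else 0) ≤ G.spectrum := by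
  rw [← Finset.sum_filter, spectrum_eq_sum_scc G,
    ← Finset.sum_subtype (Finset.univ.filter G.IsSCC) (by simp) fun S => (G.restrict S).spectrum,
    Finset.sum_congr rfl fun C _ => (spectrum_restrict_support C).symm,
    ← Finset.sum_image (s := Finset.univ.filter fun C : G.Component B => G.numCopies B C = 0)
      (g := Component.support) (f := fun S => (G.restrict S).spectrum)]
  · refine Finset.sum_le_sum_of_subset fun S hS => ?_
    obtain ⟨C, hC, rfl⟩ := Finset.mem_image.1 hS
    exact Finset.mem_filter.2 ⟨Finset.mem_univ _,
      isSCC_support_of_numCopies_eq_zero (Finset.mem_filter.1 hC).2⟩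
  · intro C _ C' _ h
    obtain ⟨x, hx⟩ := C.2.nonempty
    have hxC : (x : V) ∈ C.support := ⟨x, hx, rfl⟩
    exact Component.eq_of_mem_support hxC (h ▸ hxC)

open scoped Classical in
/-- The relation between the characteristic polynomials of a graph and its specialization. -/
theorem charpoly_specialization_mul [Fintype V] :
    (G.specialization B).cMatrix.charpoly * ∏ C : G.Component B, C.graph.cMatrix.charpoly =
      G.cMatrix.charpoly * ∏ C : G.Component B, C.graph.cMatrix.charpoly ^ G.numCopies B C := by
  have hne : ∏ C : G.Component B, C.graph.cMatrix.charpoly ≠ 0 :=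
    Finset.prod_ne_zero_iff.2 fun _ _ => (Matrix.charpoly_monic _).ne_zero
  -- The resolvents exist away from the finitely many roots of the component polynomials.
  refine Polynomial.eq_of_infinite_eval_eq _ _
    (((Finset.finite_toSet
      (∏ C : G.Component B, C.graph.cMatrix.charpoly).roots.toFinset).infinite_compl).mono ?_)
  intro lam hlam
  have hlam' : ∀ C : G.Component B, C.graph.cMatrix.charpoly.eval lam ≠ 0 := fun C h0 => by
    refine hlam ?_
    simp only [Finset.mem_coe, Multiset.mem_toFinset, Polynomial.mem_roots hne,
      Polynomial.IsRoot.def, Polynomial.eval_prod]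
    exact Finset.prod_eq_zero (Finset.mem_univ C) h0
  obtain ⟨K, hK⟩ := exists_isBlockResolvent lam hlam'
  change Polynomial.eval lam _ = Polynomial.eval lam _
  have h1 := hK.eval_charpoly
  have h2 := hK.eval_charpoly_specialization
  rw [Polynomial.eval_mul, Polynomial.eval_mul, h2, h1, Polynomial.eval_prod, Polynomial.eval_prod]
  simp only [Polynomial.eval_pow]
  rw [mul_right_comm]

open scoped Classical in
theorem spectrum_specialization_add [Fintype V] :
    (G.specialization B).spectrum + ∑ C : G.Component B, C.graph.spectrum =
      G.spectrum + ∑ C : G.Component B, G.numCopies B C • C.graph.spectrum := by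
  have h0 : ∀ C : G.Component B, C.graph.cMatrix.charpoly ≠ 0 := fun _ =>
    (Matrix.charpoly_monic _).ne_zero
  have h := congrArg Polynomial.roots (charpoly_specialization_mul (G := G) (B := B))
  rw [Polynomial.roots_mul (mul_ne_zero (Matrix.charpoly_monic _).ne_zero
      (Finset.prod_ne_zero_iff.2 fun C _ => h0 C)),
    Polynomial.roots_mul (mul_ne_zero (Matrix.charpoly_monic _).ne_zero
      (Finset.prod_ne_zero_iff.2 fun C _ => pow_ne_zero _ (h0 C))),
    Polynomial.roots_prod_eq_sum _ _ h0,
    Polynomial.roots_prod_eq_sum _ _ fun C => pow_ne_zero _ (h0 C)] at h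
  simp only [Polynomial.roots_pow] at h
  simp only [spectrum_eq_roots]
  exact h

end WeightedDigraph

theorem theorem1 {V : Type*} [Finite V] (G : WeightedDigraph V) (B : Set V)
    (m : ℕ) (C : Fin m ≃ G.Component B) :
    (G.specialization B).spectrum =
      (List.finRange m).foldl
        (fun A i => adjoinCopies A (C i).graph.spectrum ((G.numCopies B (C i) : ℤ) - 1))
        G.spectrum := by
  classical
  have := Fintype.ofFinite V
  symm
  apply foldl_adjoinCopies_eq (fun i => (C i).graph.spectrum) (fun i => G.numCopies B (C i))
  · rw [← Fin.sum_univ_def, ← Fin.sum_univ_def, C.sum_comp fun D => D.graph.spectrum,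
      C.sum_comp fun D => G.numCopies B D • D.graph.spectrum]
    convert WeightedDigraph.spectrum_specialization_add (G := G) (B := B)
  · rw [← Fin.sum_univ_def,
      C.sum_comp fun D => if G.numCopies B D = 0 then D.graph.spectrum else 0]
    convert WeightedDigraph.sum_spectrum_le (G := G) (B := B)
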